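/- Call a unital normed complex algebra $A$ with completion $\hat A$ a \emph{local Banach algebra} if for every $k$ the matrix algebra $M_k(A)$ is closed under the holomorphic functional calculus of $M_k(\hat A)$; that is, $g(x)\in M_k(A)$ whenever $x\in M_k(A)$ and $g$ is holomorphic on an open neighbourhood of the spectrum of $x$ in $M_k(\hat A)$. A \emph{local $C^*$-algebra} is a local Banach algebra $A$ with a conjugate-linear involution $x\mapsto x^*$ (satisfying $(xy)^*=y^*x^*$) such that $\|x^*x\|=\|x\|^2$ for all $x\in A$. \textbf{Proposition.} Let $A$ be a unital local $C^*$-algebra, let $n\ge 2$ be an integer, and let $e,f\in A$ be $n$-potents, i.e. $e^n=e$ and $f^n=f$. (a) If $e$ and $f$ are unitarily equivalent, i.e. $ueu^*=f$ for some unitary $u\in A$ ($u^*u=uu^*=1$), then they are similar, i.e. $f=zez^{-1}$ for some invertible $z\in A$. (b) If $e$ and $f$ are normal ($ee^*=e^*e$ and $ff^*=f^*f$) and similar, then they are unitarily equivalent. -/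

import Mathlib

/-- The winding number about `w` of the cycle formed by the closed curves
`γ i`, each parametrised by `[0, 1]`. -/
noncomputable def windingNumber {m : ℕ} (γ : Fin m → ℝ → ℂ) (w : ℂ) : ℂ :=
  (2 * (Real.pi : ℂ) * Complex.I)⁻¹ *
    ∑ i, ∫ t in (0 : ℝ)..1, deriv (γ i) t / (γ i t - w)

/-- `γ` is a cycle of finitely many closed continuously differentiable curves, lying in `U \ K`,
winding once around each point of `K` and not at all around the points outside `U`.
For `K` compact and `U` an open neighbourhood of `K` such a cycle always exists (polygonal curves
can be parametrised in a continuously differentiable way, slowing down at the corners). Only the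
values of the `γ i` on `[0, 1]` matter. -/
structure IsCycleAround {m : ℕ} (γ : Fin m → ℝ → ℂ) (K U : Set ℂ) : Prop where
  contDiff : ∀ i, ContDiff ℝ 1 (γ i)
  closed : ∀ i, γ i 0 = γ i 1
  mem : ∀ i, ∀ t ∈ Set.Icc (0 : ℝ) 1, γ i t ∈ U \ K
  winding_eq_one : ∀ w ∈ K, windingNumber γ w = 1
  winding_eq_zero : ∀ w, w ∉ U → windingNumber γ w = 0

/-- The Cauchy (Riesz-Dunford) integral `(2πi)⁻¹ ∮_γ f(w) (w - x)⁻¹ dw` in a Banach algebra. -/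
noncomputable def rieszIntegral {B : Type*} [NormedRing B] [NormedAlgebra ℂ B] [CompleteSpace B]
    {m : ℕ} (γ : Fin m → ℝ → ℂ) (f : ℂ → ℂ) (x : B) : B :=
  (2 * (Real.pi : ℂ) * Complex.I)⁻¹ •
    ∑ i, ∫ t in (0 : ℝ)..1, (deriv (γ i) t * f (γ i t)) • resolvent x (γ i t)

/-- A subset `S` of a unital complex Banach algebra `B` is closed under the holomorphic functional
calculus of `B`: whenever `x ∈ S` and `f` is holomorphic on an open neighbourhood `U` of the
spectrum of `x` in `B`, the element `f(x)`, i.e. the Riesz-Dunford integral over any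
cycle in `U` around the spectrum, belongs to `S`. -/
def ClosedUnderHolomorphicCalculus {B : Type*} [NormedRing B] [NormedAlgebra ℂ B]
    [CompleteSpace B] (S : Set B) : Prop :=
  ∀ x ∈ S, ∀ U : Set ℂ, IsOpen U → spectrum ℂ x ⊆ U →
    ∀ f : ℂ → ℂ, DifferentiableOn ℂ f U →
      ∀ (m : ℕ) (γ : Fin m → ℝ → ℂ), IsCycleAround γ (spectrum ℂ x) U → rieszIntegral γ f x ∈ S

/-- The completion of a normed complex algebra is a Banach algebra: its algebra
structure and its norm are the ones that extend those of the given algebra. -/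
@[reducible] noncomputable def completionNormedAlgebra (A : Type*) [NormedRing A]
    [NormedAlgebra ℂ A] : NormedAlgebra ℂ (UniformSpace.Completion A) where
  __ : Algebra ℂ (UniformSpace.Completion A) := UniformSpace.Completion.algebra A ℂ
  norm_smul_le := norm_smul_le

section LocalBanach

attribute [local instance] completionNormedAlgebra Matrix.linftyOpNormedRing
  Matrix.linftyOpNormedAlgebra

theorem completeSpace_matrix_completion (A : Type*) [NormedRing A] (k : ℕ) :
    @CompleteSpace (Matrix (Fin k) (Fin k) (UniformSpace.Completion A))
      Matrix.linftyOpNormedRing.toMetricSpace.toUniformSpace :=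
  Matrix.instCompleteSpace (Fin k) (Fin k) (UniformSpace.Completion A)

attribute [local instance] completeSpace_matrix_completion

/-- A (unital) normed complex algebra `A` is a local Banach algebra if each matrix algebra `M_k(A)`
is closed under the holomorphic functional calculus of its completion `M_k(Â)`, where `Â` is the
completion of `A`. (The choice of algebra norm on the matrices over `Â` is immaterial, as all the
usual ones are equivalent.) -/
def IsLocalBanachAlgebra (A : Type*) [NormedRing A] [NormedAlgebra ℂ A] : Prop :=
  ∀ k : ℕ, ClosedUnderHolomorphicCalculus
    (Set.range fun M : Matrix (Fin k) (Fin k) A =>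
      M.map (fun a : A => (a : UniformSpace.Completion A)))

end LocalBanach

/-- A (unital) local C⋆-algebra: a local Banach algebra with a conjugate-linear involution that
satisfies the C⋆-identity (which makes the involution isometric). -/
structure IsLocalCStarAlgebra (A : Type*) [NormedRing A] [NormedAlgebra ℂ A] [StarRing A]
    [StarModule ℂ A] : Prop where
  isLocalBanachAlgebra : IsLocalBanachAlgebra A
  norm_star_mul_self : ∀ x : A, ‖star x * x‖ = ‖x‖ ^ 2

/-- `e` is an `n`-potent. -/
def IsNPotent {R : Type*} [Ring R] (n : ℕ) (e : R) : Prop := e ^ n = e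

/-- `e` and `f` are similar: `f = z e z⁻¹` for some invertible `z`. -/
def IsSimilarTo {R : Type*} [Ring R] (e f : R) : Prop :=
  ∃ z : Rˣ, f = (z : R) * e * ((z⁻¹ : Rˣ) : R)

/-- `e` and `f` are unitarily equivalent: `u e u⋆ = f` for some unitary `u`. -/
def IsUnitarilyEquivalentTo {R : Type*} [Ring R] [StarRing R] (e f : R) : Prop :=
  ∃ u ∈ unitary R, u * e * star u = f

/-! A unitary is invertible with inverse `star u`, which gives (a). For (b), the spectrum of a
normal `n`-potent consists of `0` and `(n-1)`-th roots of unity, so its adjoint is a power of it,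
with an exponent depending only on `n`. Hence `z e = f z` implies `z e⋆ = f⋆ z`, and by adjunction
`e z⋆ = z⋆ f`. So `z⋆ z` commutes with `e`, and so does `b = (z⋆ z)^(-1/2)`. The unitary part `u = z
b` of the polar decomposition then satisfies `u e u⋆ = f`.

The analytic point is that `b` lies in `A` (`exists_inverse_sqrt`). The spectrum of `z⋆ z` in the
completion is a compact set of positive reals, so one circle inside the slit plane surrounds it, and
the Riesz integral of `w ^ (-1/2)` over that circle lies in `A`. This integral equals the continuous
functional calculus (`rieszIntegral_unitCircleMap_eq_cfc`), from which the properties of `b` are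
read off. -/

open Complex Set Metric

/-! ### Circles as cycles, and the Riesz integral over them -/

/-- The circle with centre `c` and radius `r`, run through once on `[0, 1]`. -/
noncomputable def unitCircleMap (c : ℂ) (r : ℝ) (t : ℝ) : ℂ :=
  circleMap c r (2 * Real.pi * t)

theorem contDiff_unitCircleMap (c : ℂ) (r : ℝ) : ContDiff ℝ 1 (unitCircleMap c r) :=
  (contDiff_circleMap c r).comp (contDiff_const.mul contDiff_id)

theorem deriv_unitCircleMap (c : ℂ) (r t : ℝ) :
    deriv (unitCircleMap c r) t =
      (2 * Real.pi) • deriv (circleMap c r) (2 * Real.pi * t) :=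
  deriv_comp_mul_left (2 * Real.pi) (circleMap c r) t

theorem unitCircleMap_mem_sphere (c : ℂ) {r : ℝ} (hr : 0 ≤ r) (t : ℝ) :
    unitCircleMap c r t ∈ sphere c r :=
  circleMap_mem_sphere c hr _

theorem integral_unitCircleMap {E : Type*} [NormedAddCommGroup E] [NormedSpace ℂ E]
    (c : ℂ) (r : ℝ) (F : ℂ → E) :
    ∫ t in (0 : ℝ)..1, deriv (unitCircleMap c r) t • F (unitCircleMap c r t) =
      ∮ z in C(c, r), F z := by
  have h := intervalIntegral.smul_integral_comp_mul_left (a := 0) (b := 1)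
    (fun θ : ℝ => deriv (circleMap c r) θ • F (circleMap c r θ)) (2 * Real.pi)
  rw [mul_zero, mul_one] at h
  rw [circleIntegral, ← h, ← intervalIntegral.integral_smul]
  simp only [deriv_unitCircleMap, unitCircleMap, smul_assoc]

theorem windingNumber_unitCircleMap (c : ℂ) (r : ℝ) (w : ℂ) :
    windingNumber (fun _ : Fin 1 => unitCircleMap c r) w =
      (2 * (Real.pi : ℂ) * I)⁻¹ * ∮ z in C(c, r), (z - w)⁻¹ := by
  simp only [windingNumber, Finset.univ_unique, Finset.sum_singleton, div_eq_mul_inv]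
  rw [← integral_unitCircleMap]
  rfl

theorem isCycleAround_unitCircleMap {c : ℂ} {r : ℝ} (hr : 0 ≤ r) {K U : Set ℂ}
    (hK : K ⊆ ball c r) (hU : closedBall c r ⊆ U) :
    IsCycleAround (fun _ : Fin 1 => unitCircleMap c r) K U where
  contDiff _ := contDiff_unitCircleMap c r
  closed _ := by
    have := periodic_circleMap c r 0
    simp only [unitCircleMap, mul_zero, mul_one, zero_add] at this ⊢
    exact this.symm
  mem _ t _ := by
    have h := unitCircleMap_mem_sphere c hr t
    exact ⟨hU (sphere_subset_closedBall h),
      fun hk => sphere_disjoint_ball.le_bot ⟨h, hK hk⟩⟩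
  winding_eq_one w hw := by
    rw [windingNumber_unitCircleMap, circleIntegral.integral_sub_inv_of_mem_ball (hK hw),
      inv_mul_cancel₀ two_pi_I_ne_zero]
  winding_eq_zero w hw := by
    have hd : DifferentiableOn ℂ (fun z => (z - w)⁻¹) (closedBall c r) := fun z hz =>
      ((differentiableAt_id.sub_const w).inv
        (sub_ne_zero.2 fun h => hw (h ▸ hU hz))).differentiableWithinAt
    rw [windingNumber_unitCircleMap,
      (hd.mono closure_ball_subset_closedBall).diffContOnCl.circleIntegral_eq_zero hr, mul_zero]

/-- Over a circle around the spectrum of a normal element of a C⋆-algebra, the Riesz-Dunford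
integral is the continuous functional calculus. -/
theorem rieszIntegral_unitCircleMap_eq_cfc {B : Type*} [CStarAlgebra B] (x : B) [IsStarNormal x]
    {c : ℂ} {r : ℝ} (hr : 0 ≤ r) (hx : spectrum ℂ x ⊆ ball c r) {f : ℂ → ℂ}
    (hf : DifferentiableOn ℂ f (closedBall c r)) :
    rieszIntegral (fun _ : Fin 1 => unitCircleMap c r) f x = cfc f x := by
  set γ := unitCircleMap c r
  have hγs : ∀ t, γ t ∈ sphere c r := unitCircleMap_mem_sphere c hr
  have hne : ∀ t, ∀ w ∈ spectrum ℂ x, γ t - w ≠ 0 := fun t w hw h =>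
    sphere_disjoint_ball.le_bot ⟨hγs t, sub_eq_zero.1 h ▸ hx hw⟩
  have hγc : Continuous γ := (contDiff_unitCircleMap c r).continuous
  have hγd : Continuous (deriv γ) := (contDiff_unitCircleMap c r).continuous_deriv le_rfl
  have hfγ : Continuous fun t => f (γ t) :=
    hf.continuousOn.comp_continuous hγc fun t => sphere_subset_closedBall (hγs t)
  let g : ℝ → ℂ → ℂ := fun t w => deriv γ t * f (γ t) * (γ t - w)⁻¹
  have hg : ContinuousOn (Function.uncurry g) (univ ×ˢ spectrum ℂ x) := by
    refine ContinuousOn.mul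
      ((hγd.comp continuous_fst).mul (hfγ.comp continuous_fst)).continuousOn (ContinuousOn.inv₀ (by fun_prop) ?_)
    rintro ⟨t, w⟩ ⟨-, hw⟩
    exact hne t w hw
  obtain ⟨M, hM⟩ := (isCompact_Icc.prod (spectrum.isCompact x)).exists_bound_of_continuousOn
    (hg.mono (prod_mono (subset_univ (Icc (0 : ℝ) 1)) Subset.rfl))
  -- The resolvent at `γ t` is the functional calculus of `w ↦ (γ t - w)⁻¹`; once the integral is
  -- moved inside `cfc`, only the scalar Cauchy formula on the spectrum remains.
  have hres : ∀ t, (deriv γ t * f (γ t)) • resolvent x (γ t) = cfc (g t) x := fun t => by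
    have h1 : algebraMap ℂ B (γ t) - x = cfc (fun w => γ t - w) x := by
      rw [cfc_sub (fun _ => γ t) (fun w => w) x, cfc_const (γ t) x, cfc_id' ℂ x]
    have hc : ContinuousOn (fun w => (γ t - w)⁻¹) (spectrum ℂ x) :=
      ContinuousOn.inv₀ (by fun_prop) (hne t)
    rw [resolvent, h1, ← cfc_inv (fun w => γ t - w) x (hne t), ← cfc_const_mul _ _ x hc]
  have hint : ∫ t in (0 : ℝ)..1, cfc (g t) x = cfc (fun w => ∫ t in (0 : ℝ)..1, g t w) x := by
    simp only [intervalIntegral.integral_of_le zero_le_one]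
    refine (cfc_setIntegral measurableSet_Ioc g (fun _ => M) x
      (hg.mono (prod_mono (subset_univ _) Subset.rfl)) ?_ ?_).symm
    · exact MeasureTheory.ae_restrict_of_forall_mem measurableSet_Ioc fun t ht w hw =>
        hM (t, w) ⟨Ioc_subset_Icc_self ht, hw⟩
    · exact MeasureTheory.hasFiniteIntegral_const M
  have hval : ∀ w ∈ spectrum ℂ x, ∫ t in (0 : ℝ)..1, g t w = (2 * Real.pi * I) * f w :=
    fun w hw => by
      rw [← smul_eq_mul (2 * Real.pi * I), ← hf.circleIntegral_sub_inv_smul (hx hw),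
        ← integral_unitCircleMap]
      exact intervalIntegral.integral_congr fun t _ => by simp only [g, smul_eq_mul]; ring
  have hfs : ContinuousOn f (spectrum ℂ x) :=
    hf.continuousOn.mono (hx.trans ball_subset_closedBall)
  simp only [rieszIntegral, Finset.univ_unique, Finset.sum_singleton]
  rw [intervalIntegral.integral_congr fun t _ => hres t, hint, cfc_congr hval,
    cfc_const_mul _ _ x hfs, smul_smul, inv_mul_cancel₀ two_pi_I_ne_zero, one_smul]

theorem rieszIntegral_map {B C : Type*} [NormedRing B] [NormedAlgebra ℂ B] [CompleteSpace B]
    [NormedRing C] [NormedAlgebra ℂ C] [CompleteSpace C] (φ : B ≃ₐ[ℂ] C) (hφ : Continuous φ)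
    (hφ' : Continuous φ.symm) {m : ℕ} (γ : Fin m → ℝ → ℂ) (f : ℂ → ℂ) (x : B) :
    φ (rieszIntegral γ f x) = rieszIntegral γ f (φ x) := by
  let ψ : B ≃L[ℂ] C := { φ.toLinearEquiv with
    continuous_toFun := hφ
    continuous_invFun := hφ' }
  -- Non-units also match: `Ring.inverse` is `0` on both sides.
  have hinv : ∀ y, φ (Ring.inverse y) = Ring.inverse (φ y) := fun y => by
    by_cases hy : IsUnit y
    · obtain ⟨u, rfl⟩ := hy
      have : φ u = Units.map (φ : B →* C) u := rfl
      rw [this, Ring.inverse_unit, Ring.inverse_unit, ← map_inv]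
      rfl
    · rw [Ring.inverse_non_unit _ hy, map_zero,
        Ring.inverse_non_unit _ (mt (MulEquiv.isUnit_map φ).1 hy)]
  have hres : ∀ w : ℂ, resolvent (φ x) w = ψ (resolvent x w) := fun w => by
    change _ = φ _
    rw [resolvent, resolvent, hinv, map_sub, AlgEquiv.commutes]
  change ψ _ = _
  simp only [rieszIntegral, hres, map_smul, map_sum, intervalIntegral]
  -- Since `ψ` is an equivalence, it commutes with the integral without any integrability condition.
  simp only [map_sub, ← ψ.integral_comp_comm, map_smul]

/-! ### Adjoints of normal `n`-potents -/

/-- A nonzero spectral value has `w ^ (n-1) = 1`, so its conjugate is `w⁻¹ = w ^ (2(n-1)-1)`. The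
exponent `n - 2` would fail at `w = 0` when `n = 2`; `2n - 3` is always positive. -/
theorem star_eq_pow_of_pow_eq_self {B : Type*} [CStarAlgebra B] {e : B} [IsStarNormal e] {n : ℕ}
    (hn : 2 ≤ n) (he : e ^ n = e) : star e = e ^ (2 * n - 3) := by
  have hspec : (spectrum ℂ e).EqOn (fun w => w ^ n) (fun w => w) := by
    rw [← cfc_eq_cfc_iff_eqOn (a := e), cfc_pow_id e n, cfc_id' ℂ e, he]
  rw [← cfc_star_id (R := ℂ) e, ← cfc_pow_id (R := ℂ) e]
  refine cfc_congr fun w hw => ?_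
  have hwn : w ^ n = w := hspec hw
  obtain ⟨k, rfl⟩ := Nat.exists_eq_add_of_le hn
  rw [show 2 * (2 + k) - 3 = 2 * k + 1 by omega]
  rcases eq_or_ne w 0 with rfl | h0
  · simp
  have h1 : w ^ (k + 1) = 1 := by
    apply mul_right_cancel₀ h0
    rw [← pow_succ, one_mul, show k + 1 + 1 = 2 + k by omega, hwn]
  have h2 : ‖w‖ = 1 := norm_eq_one_of_pow_eq_one h1 (by omega)
  have h3 : star w * w = 1 := by
    rw [RCLike.star_def, conj_mul', h2]; simp
  apply mul_right_cancel₀ h0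
  simp only [h3]
  rw [← pow_succ, show 2 * k + 1 + 1 = (k + 1) * 2 by omega, pow_mul, h1, one_pow]

/-! ### The inverse square root of `z⋆ z` in a C⋆-algebra -/

theorem exists_closedBall_subset_slitPlane {S : Set ℝ} (hS : IsCompact S) (hpos : ∀ w ∈ S, 0 < w) :
    ∃ c r : ℝ, 0 ≤ r ∧ (∀ w ∈ S, (w : ℂ) ∈ ball (c : ℂ) r) ∧
      closedBall (c : ℂ) r ⊆ slitPlane := by
  obtain ⟨δ, hδ, hδS⟩ : ∃ δ > 0, ∀ w ∈ S, δ ≤ w := by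
    rcases S.eq_empty_or_nonempty with rfl | hne
    · exact ⟨1, one_pos, by simp⟩
    · obtain ⟨δ, hδ, h⟩ := hS.exists_isLeast hne
      exact ⟨δ, hpos δ hδ, fun w hw => h hw⟩
  obtain ⟨M, hM⟩ := hS.bddAbove
  have hc := le_max_right M δ
  -- The ball reaches left exactly to `δ / 2 > 0`. Taking `max M δ` keeps the radius positive even
  -- when `S` is empty.
  refine ⟨max M δ, max M δ - δ / 2, by linarith, fun w hw => ?_, fun z hz => Or.inl ?_⟩
  · have h1 : w ≤ max M δ := (hM hw).trans (le_max_left _ _)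
    rw [mem_ball, dist_eq, ← ofReal_sub, norm_real, Real.norm_eq_abs, abs_sub_comm,
      abs_of_nonneg (by linarith)]
    linarith [hδS w hw]
  · rw [mem_closedBall, dist_comm, dist_eq] at hz
    have := (re_le_norm _).trans hz
    rw [sub_re, ofReal_re] at this
    linarith

section InverseSqrt

variable {B : Type*} [CStarAlgebra B] {z : B}

theorem pos_of_mem_spectrum_star_mul_self (hz : IsUnit z) :
    ∀ w ∈ spectrum ℝ (star z * z), 0 < w := fun w hw =>
  (spectrum_star_mul_self_nonneg w hw).lt_of_ne fun h =>
    spectrum.zero_notMem ℝ (hz.star.mul hz) (h ▸ hw)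

theorem mem_spectrum_star_mul_self (hz : IsUnit z) {w : ℂ} (hw : w ∈ spectrum ℂ (star z * z)) :
    ∃ a ∈ spectrum ℝ (star z * z), 0 < a ∧ w = a := by
  have h := (IsSelfAdjoint.star_mul_self z).mem_spectrum_eq_re hw
  have h' : w.re ∈ spectrum ℝ (star z * z) := by
    rw [← spectrum.algebraMap_mem_iff ℂ]
    exact h ▸ hw
  exact ⟨w.re, h', pos_of_mem_spectrum_star_mul_self hz _ h', h⟩

theorem isStarNormal_star_mul_self (z : B) : IsStarNormal (star z * z) :=
  (IsSelfAdjoint.star_mul_self z).isStarNormal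

theorem exists_ball_spectrum_star_mul_self (hz : IsUnit z) :
    ∃ (c : ℂ) (r : ℝ), 0 ≤ r ∧ spectrum ℂ (star z * z) ⊆ ball c r ∧
      closedBall c r ⊆ slitPlane := by
  obtain ⟨c, r, hr, hS, hb⟩ := exists_closedBall_subset_slitPlane
    (spectrum.isCompact (𝕜 := ℝ) (star z * z)) (pos_of_mem_spectrum_star_mul_self hz)
  refine ⟨c, r, hr, fun w hw => ?_, hb⟩
  obtain ⟨a, ha, -, rfl⟩ := mem_spectrum_star_mul_self hz hw
  exact hS a ha

theorem continuousOn_cpow_spectrum_star_mul_self (hz : IsUnit z) (s : ℂ) :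
    ContinuousOn (fun w : ℂ => w ^ s) (spectrum ℂ (star z * z)) := by
  obtain ⟨c, r, -, hS, hb⟩ := exists_ball_spectrum_star_mul_self hz
  exact continuousOn_id.cpow_const fun w hw => hb (ball_subset_closedBall (hS hw))

theorem isSelfAdjoint_cfc_cpow (hz : IsUnit z) (s : ℝ) :
    IsSelfAdjoint (cfc (fun w : ℂ => w ^ (s : ℂ)) (star z * z)) := by
  rw [isSelfAdjoint_iff, ← cfc_star]
  refine cfc_congr fun w hw => ?_
  obtain ⟨a, -, ha, rfl⟩ := mem_spectrum_star_mul_self hz hw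
  simp only [← ofReal_cpow ha.le]
  exact conj_ofReal _

theorem cfc_cpow_neg_half_mul_mul (hz : IsUnit z) :
    cfc (fun w : ℂ => w ^ (-(1 / 2) : ℂ)) (star z * z) * (star z * z) *
      cfc (fun w : ℂ => w ^ (-(1 / 2) : ℂ)) (star z * z) = 1 := by
  have hn := isStarNormal_star_mul_self z
  have hc := continuousOn_cpow_spectrum_star_mul_self hz (-(1 / 2))
  nth_rw 2 [← cfc_id' ℂ (star z * z)]
  rw [← cfc_mul _ _ _ hc, ← cfc_mul (fun w : ℂ => w ^ (-(1 / 2) : ℂ) * w) _ _ (hc.mul continuousOn_id) hc,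
    ← cfc_one ℂ (star z * z)]
  refine cfc_congr fun w hw => ?_
  obtain ⟨a, -, ha, rfl⟩ := mem_spectrum_star_mul_self hz hw
  have h0 : (a : ℂ) ≠ 0 := ofReal_ne_zero.2 ha.ne'
  simp only [Pi.one_apply]
  rw [mul_right_comm, ← cpow_add _ _ h0]
  norm_num [cpow_neg_one, h0]

end InverseSqrt

/-! ### The completion as a C⋆-algebra -/

section Completion

open UniformSpace

/-- The involution of the completion of a normed algebra with isometric involution. -/
@[reducible] noncomputable def completionStar (A : Type*) [UniformSpace A] [Star A] :
    Star (Completion A) where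
  star := Completion.map star

attribute [local instance] completionStar completionNormedAlgebra

theorem completion_continuous_star (A : Type*) [UniformSpace A] [Star A] :
    Continuous (star : Completion A → Completion A) :=
  Completion.continuous_map

/-- `Completion.map` extends uniformly continuous maps; the C⋆-identity supplies this by making the
involution isometric. -/
theorem completion_star_coe {A : Type*} [NormedRing A] [StarRing A] [CStarRing A] (a : A) :
    star (a : Completion A) = ((star a : A) : Completion A) :=
  Completion.map_coe star_isometry.uniformContinuous a

/-- The completion of a normed algebra with a C⋆-norm is a C⋆-algebra. -/
@[reducible] noncomputable def completionCStarAlgebra (A : Type*) [NormedRing A]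
    [NormedAlgebra ℂ A] [StarRing A] [StarModule ℂ A] [CStarRing A] : CStarAlgebra (Completion A) :=
  have hs := completion_continuous_star A
  { (inferInstance : NormedRing (Completion A)), completionNormedAlgebra A, completionStar A with
    complete := CompleteSpace.complete
    star_involutive := fun x => by
      induction x using Completion.induction_on with
      | hp => exact isClosed_eq (hs.comp hs) continuous_id
      | ih a => simp only [completion_star_coe, star_star]
    star_mul := fun x y => by
      induction x, y using Completion.induction_on₂ with
      | hp => exact isClosed_eq (hs.comp (by fun_prop))
                ((hs.comp continuous_snd).mul (hs.comp continuous_fst))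
      | ih a b => simp only [completion_star_coe, star_mul, ← Completion.coe_mul]
    star_add := fun x y => by
      induction x, y using Completion.induction_on₂ with
      | hp => exact isClosed_eq (hs.comp (by fun_prop))
                ((hs.comp continuous_fst).add (hs.comp continuous_snd))
      | ih a b => simp only [completion_star_coe, star_add, ← Completion.coe_add]
    star_smul := fun w x => by
      induction x using Completion.induction_on with
      | hp => exact isClosed_eq (hs.comp (continuous_const_smul w)) (hs.const_smul (star w))
      | ih a => simp only [completion_star_coe, star_smul, ← Completion.coe_smul]
    norm_mul_self_le := fun x => by
      induction x using Completion.induction_on with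
      | hp => exact isClosed_le (by fun_prop) (hs.mul continuous_id).norm
      | ih a =>
        simp only [completion_star_coe, ← Completion.coe_mul, Completion.norm_coe]
        exact CStarRing.norm_mul_self_le a }

end Completion

/-! ### Descent from the completion to `A` -/

section LocalCStar

open UniformSpace

attribute [local instance] completionNormedAlgebra

section

attribute [local instance] Matrix.linftyOpNormedRing Matrix.linftyOpNormedAlgebra
  completeSpace_matrix_completion

/-- A local Banach algebra is closed under the holomorphic functional calculus of its completion. -/
theorem IsLocalBanachAlgebra.rieszIntegral_mem_range {A : Type*} [NormedRing A] [NormedAlgebra ℂ A]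
    (hA : IsLocalBanachAlgebra A) :
    ClosedUnderHolomorphicCalculus (range fun a : A => (a : Completion A)) := by
  rintro _ ⟨a, rfl⟩ U hU hx f hf m γ hγ
  -- Only the case `k = 1` is needed, transported from `M_1(Â)` to `Â`.
  let φ : Matrix (Fin 1) (Fin 1) (Completion A) ≃ₐ[ℂ] Completion A :=
    { Matrix.uniqueEquiv with
      map_mul' := fun _ _ => by simp [Matrix.mul_apply]
      map_add' := fun _ _ => rfl
      commutes' := fun _ => by simp [Matrix.algebraMap_matrix_apply] }
  have hφ : Continuous φ := continuous_id.matrix_elem default default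
  have hφ' : Continuous φ.symm := continuous_matrix fun _ _ => continuous_id
  let M : Matrix (Fin 1) (Fin 1) A := Matrix.of fun _ _ => a
  have hM : φ (M.map fun a : A => (a : Completion A)) = a := rfl
  have hs : spectrum ℂ (M.map fun a : A => (a : Completion A)) =
      spectrum ℂ (a : Completion A) := by
    rw [← hM, AlgEquiv.spectrum_eq]
  obtain ⟨N, hN⟩ := hA 1 _ ⟨M, rfl⟩ U hU (hs ▸ hx) f hf m γ (hs ▸ hγ)
  have h := congrArg φ hN
  rw [rieszIntegral_map φ hφ hφ'] at h
  exact ⟨N default default, h⟩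

end

attribute [local instance] completionCStarAlgebra

variable {A : Type*} [NormedRing A] [NormedAlgebra ℂ A] [StarRing A] [StarModule ℂ A]

theorem IsLocalCStarAlgebra.cStarRing (hA : IsLocalCStarAlgebra A) : CStarRing A where
  norm_mul_self_le x := by rw [hA.norm_star_mul_self, sq]

theorem star_eq_pow_of_isNPotent [CStarRing A] {e : A} [IsStarNormal e] {n : ℕ} (hn : 2 ≤ n)
    (he : IsNPotent n e) : star e = e ^ (2 * n - 3) := by
  have hcoe : ∀ k : ℕ, ((e ^ k : A) : Completion A) = (e : Completion A) ^ k :=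
    map_pow Completion.coeRingHom e
  have : IsStarNormal (e : Completion A) := ⟨by
    rw [Commute, SemiconjBy, completion_star_coe, ← Completion.coe_mul, ← Completion.coe_mul,
      star_comm_self' e]⟩
  apply Completion.coe_injective A
  rw [hcoe, ← completion_star_coe]
  exact star_eq_pow_of_pow_eq_self hn (by rw [← hcoe, he])

/-- In a local C⋆-algebra `(z⋆ z)^(-1/2)` exists for invertible `z`. -/
theorem IsLocalCStarAlgebra.exists_inverse_sqrt (hA : IsLocalCStarAlgebra A) {z : A}
    (hz : IsUnit z) : ∃ b : A, IsSelfAdjoint b ∧ b * (star z * z) * b = 1 ∧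
      ∀ y, Commute (star z * z) y → Commute b y := by
  have := hA.cStarRing
  have hz' : IsUnit (z : Completion A) := hz.map Completion.coeRingHom
  obtain ⟨c, r, hr, hS, hb⟩ := exists_ball_spectrum_star_mul_self hz'
  have hx : ((star z * z : A) : Completion A) = star (z : Completion A) * z := by
    rw [Completion.coe_mul, completion_star_coe]
  have hS' : spectrum ℂ ((star z * z : A) : Completion A) ⊆ ball c r := hx ▸ hS
  have hd : DifferentiableOn ℂ (fun w : ℂ => w ^ (-(1 / 2) : ℂ)) slitPlane :=
    differentiableOn_id.cpow_const fun w hw => hw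
  have := isStarNormal_star_mul_self (z : Completion A)
  obtain ⟨b, hbr⟩ := hA.isLocalBanachAlgebra.rieszIntegral_mem_range _ ⟨star z * z, rfl⟩
    slitPlane isOpen_slitPlane (hS'.trans (ball_subset_closedBall.trans hb)) _ hd 1 _
    (isCycleAround_unitCircleMap hr hS' hb)
  have hbc : (b : Completion A) =
      cfc (fun w : ℂ => w ^ (-(1 / 2) : ℂ)) (star (z : Completion A) * z) := by
    rw [← rieszIntegral_unitCircleMap_eq_cfc _ hr hS (hd.mono hb), ← hx]
    exact hbr
  have hinj := Completion.coe_injective A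
  refine ⟨b, hinj ?_, hinj ?_, fun y hy => hinj ?_⟩
  · rw [← completion_star_coe, hbc]
    simpa [isSelfAdjoint_iff] using isSelfAdjoint_cfc_cpow hz' (-(1 / 2))
  · rw [Completion.coe_mul, Completion.coe_mul, hx, hbc, cfc_cpow_neg_half_mul_mul hz']
    rfl
  · rw [Completion.coe_mul, Completion.coe_mul, hbc]
    -- For a self-adjoint element, commuting with it suffices; no condition on its adjoint is
    -- needed.
    refine (IsSelfAdjoint.star_mul_self _).commute_cfc ?_ _
    rw [← hx, Commute, SemiconjBy, ← Completion.coe_mul, ← Completion.coe_mul, hy]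

end LocalCStar

/-! ### Similarity and unitary equivalence -/

theorem IsUnitarilyEquivalentTo.isSimilarTo {R : Type*} [Ring R] [StarRing R] {e f : R}
    (h : IsUnitarilyEquivalentTo e f) : IsSimilarTo e f := by
  obtain ⟨u, hu, rfl⟩ := h
  exact ⟨Unitary.toUnits ⟨u, hu⟩, rfl⟩

theorem isUnitarilyEquivalentTo_of_inverse_sqrt {R : Type*} [Ring R] [StarRing R] {e f b : R}
    (z : Rˣ) (hf : f = z * e * (z⁻¹ : Rˣ)) (hb : IsSelfAdjoint b)
    (hbz : b * (star (z : R) * z) * b = 1) (hbx : Commute b (star (z : R) * z))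
    (hbe : Commute b e) : IsUnitarilyEquivalentTo e f := by
  -- `b b z⋆` is a left inverse of the unit `z`, hence also a right inverse; this makes `z b` a
  -- co-isometry.
  have hbb : z * (b * b) * star (z : R) = 1 := by
    have h : b * b * star (z : R) * z = 1 := by
      rw [mul_assoc, mul_assoc, hbx.eq, ← mul_assoc, hbz]
    rw [mul_assoc, Units.mul_eq_one_iff_eq_inv.1 h, Units.mul_inv]
  refine ⟨z * b, Unitary.mem_iff.2 ⟨?_, ?_⟩, ?_⟩
  · rw [star_mul, hb.star_eq, ← hbz]
    simp only [mul_assoc]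
  · rw [star_mul, hb.star_eq, ← hbb]
    simp only [mul_assoc]
  · rw [star_mul, hb.star_eq, hf, Units.eq_mul_inv_iff_mul_eq]
    calc z * b * e * (b * star (z : R)) * z = z * (b * e) * b * (star (z : R) * z) := by
          simp only [mul_assoc]
      _ = z * e * (b * (b * (star (z : R) * z))) := by rw [hbe.eq]; simp only [mul_assoc]
      _ = z * e := by rw [hbx.eq, ← mul_assoc b, hbz, mul_one]

theorem mainTheorem9 {A : Type*} [NormedRing A] [NormedAlgebra ℂ A] [StarRing A] [StarModule ℂ A]
    (hA : IsLocalCStarAlgebra A) (n : ℕ) (hn : 2 ≤ n) (e f : A)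
    (he : IsNPotent n e) (hf : IsNPotent n f) :
    (IsUnitarilyEquivalentTo e f → IsSimilarTo e f) ∧
      (IsStarNormal e → IsStarNormal f → IsSimilarTo e f → IsUnitarilyEquivalentTo e f) := by
  refine ⟨IsUnitarilyEquivalentTo.isSimilarTo, ?_⟩
  rintro _ _ ⟨z, hz⟩
  have := hA.cStarRing
  have hsz : SemiconjBy (z : A) e f := by rw [hz, SemiconjBy, Units.inv_mul_cancel_right]
  -- `z` intertwines equal powers of `e` and `f`, hence their adjoints; then take adjoints.
  have hsz' : SemiconjBy (star (z : A)) f e := by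
    have h := (hsz.pow_right (2 * n - 3)).eq
    rw [← star_eq_pow_of_isNPotent hn he, ← star_eq_pow_of_isNPotent hn hf] at h
    simpa [SemiconjBy] using (congrArg star h).symm
  obtain ⟨b, hb, hbz, hbc⟩ := hA.exists_inverse_sqrt z.isUnit
  exact isUnitarilyEquivalentTo_of_inverse_sqrt z hz hb hbz (hbc _ (Commute.refl _))
    (hbc _ (hsz'.mul_left hsz))
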